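/- Consider three-layer feedforward networks with $L_1$ agents in the first layer, $L_2$ agents in the second layer and a single final agent, which receives the estimates of all second-layer agents. The first-layer agent $j$ makes a measurement $x_j \sim \mathcal N(s, \sigma_j^2)$ of an unknown parameter $s \in \mathbb R$, with known variance $0 < \sigma_j^2 < \infty$; the measurements are independent, and there is a flat prior on $s$. First-layer agents communicate their measurements. Each second-layer agent that receives at least one measurement communicates the maximum-likelihood estimate based on the measurements it receives, namely their average weighted by the precisions $w_j = 1/\sigma_j^2$; an agent that receives none makes no estimate. The final estimate $\hat s$ is the maximum-likelihood estimate of $s$ given the (jointly normal) second-layer estimates, where redundant second-layer estimates, that is, fixed linear combinations of the retained ones, are discarded so that the covariance matrix of the retained estimates is invertible. The ideal estimate is $\hat s_{\text{ideal}} = \operatorname{argmax}_s\, p(s \mid x_1, \dots, x_{L_1})$. The network is called ideal, written $\hat s = \hat s_{\text{ideal}}$, if the final estimate equals the ideal estimate for all values of the measurements; if no second-layer agent receives a measurement, the network is not ideal. Suppose that each of the $L_1 L_2$ possible connections from the first to the second layer is present with probability $1/2$, independently of the others. Then, for any choice of the variances (which may depend on $L_1$ and $L_2$), as $L_1, L_2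 \to \infty$: $$\text{if } L_1/L_2 \le 1 \text{ along the limit, then } P(\hat s = \hat s_{\text{ideal}}) \to 1;$$ $$\text{if } L_1/L_2 > 1 \text{ along the limit, then } P(\hat s = \hat s_{\text{ideal}}) \to 0.$$ -/

import Mathlib

open scoped NNReal Topology
open Filter MeasureTheory

noncomputable section

namespace FeedforwardInference

/-- The density at `y` of the multivariate normal law with mean `m` and (invertible) covariance
matrix `R`. -/
def normalDensity {ι : Type*} [Fintype ι] [DecidableEq ι]
    (m : ι → ℝ) (R : Matrix ι ι ℝ) (y : ι → ℝ) : ℝ :=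
  (Real.sqrt ((2 * Real.pi) ^ Fintype.card ι * R.det))⁻¹ *
    Real.exp (-((y - m) ⬝ᵥ R⁻¹.mulVec (y - m)) / 2)

/-- `t` is a maximum-likelihood estimate for the likelihood function `ℓ` of the parameter `s`:
it maximizes `ℓ` over the whole real line. -/
def IsMaxLikelihood (ℓ : ℝ → ℝ) (t : ℝ) : Prop :=
  IsMaxOn ℓ Set.univ t

/-- `t` is an ideal estimate of `s` from all the measurements `x`. The measurements are independent,
`x i` being normal with mean `s` and variance `v i`. Under a flat prior the posterior density of `s`
given `x` is proportional to the likelihood, so both have the same maximizers. -/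
def IsIdealEstimate {L₁ : ℕ} (v : Fin L₁ → ℝ≥0) (x : Fin L₁ → ℝ) (t : ℝ) : Prop :=
  IsMaxLikelihood (fun s => ∏ i, ProbabilityTheory.gaussianPDFReal s (v i) (x i)) t

/-- The weights that second-layer agents apply to the first-layer estimates, which are the
measurements themselves. `C i j = true` means that the first-layer agent `j` communicates with the
second-layer agent `i`. Each second-layer agent weights what it receives by precision. -/
def secondLayerWeights {L₁ L₂ : ℕ} (v : Fin L₁ → ℝ≥0) (C : Fin L₂ → Fin L₁ → Bool) :
    Matrix (Fin L₂) (Fin L₁) ℝ :=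
  Matrix.of fun i j =>
    if C i j = true then (v j : ℝ)⁻¹ / ∑ k with C i k = true, (v k : ℝ)⁻¹ else 0

/-- The vector of second-layer estimates. -/
def secondLayerEstimates {L₁ L₂ : ℕ} (v : Fin L₁ → ℝ≥0) (C : Fin L₂ → Fin L₁ → Bool)
    (x : Fin L₁ → ℝ) : Fin L₂ → ℝ :=
  (secondLayerWeights v C).mulVec x

/-- The covariance matrix of the second-layer estimates. -/
def secondLayerCovariance {L₁ L₂ : ℕ} (v : Fin L₁ → ℝ≥0) (C : Fin L₂ → Fin L₁ → Bool) :
    Matrix (Fin L₂) (Fin L₂) ℝ :=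
  secondLayerWeights v C * Matrix.diagonal (fun j => (v j : ℝ)) * (secondLayerWeights v C).transpose

/-- The covariance matrix of the estimates of the second-layer agents in `S`. -/
def retainedCovariance {L₁ L₂ : ℕ} (v : Fin L₁ → ℝ≥0) (C : Fin L₂ → Fin L₁ → Bool)
    (S : Finset (Fin L₂)) : Matrix S S ℝ :=
  (secondLayerCovariance v C).submatrix (fun i => (i : Fin L₂)) (fun i => (i : Fin L₂))

/-- The edges from the second-layer agents outside `S` to the final agent can be removed as
redundant: the estimates of the agents in `S` have an invertible covariance matrix, and every other
second-layer estimate is a fixed linear combination of them. An agent that receives nothing has only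
zero weights, makes no estimate, and is never in `S`. -/
def IsRetained {L₁ L₂ : ℕ} (v : Fin L₁ → ℝ≥0) (C : Fin L₂ → Fin L₁ → Bool)
    (S : Finset (Fin L₂)) : Prop :=
  IsUnit (retainedCovariance v C S) ∧
    ∀ i, secondLayerWeights v C i ∈
      Submodule.span ℝ (secondLayerWeights v C '' (S : Set (Fin L₂)))

/-- `t` is a final estimate of `s`: a maximum-likelihood estimate from the (non-redundant)
second-layer estimates, which are jointly normal with common mean `s`. -/
def IsFinalEstimate {L₁ L₂ : ℕ} (v : Fin L₁ → ℝ≥0) (C : Fin L₂ → Fin L₁ → Bool)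
    (x : Fin L₁ → ℝ) (t : ℝ) : Prop :=
  ∃ S : Finset (Fin L₂), IsRetained v C S ∧
    IsMaxLikelihood
      (fun s => normalDensity (fun _ : S => s) (retainedCovariance v C S)
        (fun i : S => secondLayerEstimates v C x i)) t

/-- The three-layer network is ideal: whatever the measurements, the final estimate is the ideal
estimate. -/
def IsIdealNetwork {L₁ L₂ : ℕ} (v : Fin L₁ → ℝ≥0) (C : Fin L₂ → Fin L₁ → Bool) : Prop :=
  ∀ (x : Fin L₁ → ℝ) (t : ℝ), IsFinalEstimate v C x t ↔ IsIdealEstimate v x t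

/-- The law of a random connection pattern from `L₁` first-layer to `L₂` second-layer agents:
the possible connections are present independently, each with probability `1 / 2`. -/
def randomConnections (L₁ L₂ : ℕ) : Measure (Fin L₂ → Fin L₁ → Bool) :=
  Measure.pi fun _ => Measure.pi fun _ =>
    ProbabilityTheory.bernoulliMeasure true false ⟨1 / 2, by norm_num, by norm_num⟩

end FeedforwardInference

end

/-! # Ideal inference in random three-layer networks

A network is ideal exactly when the all-ones vector lies in the real span of the rows of the
connection matrix `C`. Maximum-likelihood estimates solve linear equations
(`isMaxLikelihood_normalDensity_iff`, `isIdealEstimate_iff`); the ideal estimate weights the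
measurements by the precision vector, and the final estimate is a combination of the second-layer
estimates. If the precision vector is a combination of the second-layer weights, its coefficients
solve the normal equations of the final agent (`isIdealNetwork_of_one_mem_span`); conversely an
ideal final estimate exhibits it as such a combination (`one_mem_span_of_isIdealNetwork`). Up to
scaling rows and columns, the weights are the connections, so the variances play no role.

Both limits now follow from Komlós's theorem, that a uniformly random square `0`-`1` matrix has
linearly dependent rows with probability tending to `0` (`tendsto_density_dependentRows`). If
`L₁ ≤ L₂`, the first `L₁` rows of `C` form a random square matrix, and if it is nonsingular, its
rows span everything, in particular the all-ones vector. If `L₂ < L₁`, complement each row whose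
first entry is `1` and keep the next `L₂` columns. The result is again a uniformly random square
matrix, and it is singular whenever the all-ones vector is in the span of the rows of `C`
(`xorColumns_mem_dependentRows`).

Komlós's theorem is proved with a threshold `k` of order `n ^ (3 / 4)`. A null vector with at most
`k` nonzero coordinates is unlikely by a union bound (`density_sparseNull_le`). If a linear relation
between the rows involves more than `k` of them, each of these is in the span of the others. By
Markov's inequality, this has probability at most `n / k` times the probability that a given row is
in the span of the others, hence orthogonal to a vector that depends on the others alone. Unless
that vector is sparse, which is again unlikely, the Littlewood–Offord inequality bounds the
probability by `k ^ (-1 / 2)` (`density_row_mem_span_le`).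
-/

noncomputable section

namespace FeedforwardInference

/-! ### Maximum-likelihood estimates as solutions of linear equations -/

theorem isMaxLikelihood_iff_of_eq_exp_quadratic {ℓ : ℝ → ℝ} {c A B G : ℝ} (hc : 0 < c)
    (hG : 0 ≤ G) (hℓ : ∀ s, ℓ s = c * Real.exp (-(A - 2 * B * s + G * s ^ 2) / 2)) (t : ℝ) :
    IsMaxLikelihood ℓ t ↔ B = G * t := by
  have key : IsMaxLikelihood ℓ t ↔
      ∀ s, A - 2 * B * t + G * t ^ 2 ≤ A - 2 * B * s + G * s ^ 2 := by
    simp only [IsMaxLikelihood, isMaxOn_iff, Set.mem_univ, true_imp_iff, hℓ]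
    refine forall_congr' fun s => ?_
    rw [mul_le_mul_iff_right₀ hc, Real.exp_le_exp]
    constructor <;> intro h <;> linarith
  rw [key]
  constructor
  · intro h
    -- the minimum is compared with the value at a damped Newton step, valid also when `G = 0`
    have h1 := h (t + (B - G * t) / (G + 1))
    have hG1 : 0 < G + 1 := by linarith
    obtain ⟨e, he⟩ : ∃ e, e = (B - G * t) / (G + 1) := ⟨_, rfl⟩
    rw [← he] at h1
    have hd : B - G * t = e * (G + 1) := by rw [he]; field_simp
    have h2 : e ^ 2 * (G + 2) ≤ 0 := by
      have hB : B = e * (G + 1) + G * t := by linarith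
      rw [hB] at h1
      nlinarith
    have he0 : e = 0 := by
      have : e ^ 2 ≤ 0 := by nlinarith [sq_nonneg e]
      exact pow_eq_zero_iff (two_ne_zero) |>.1 (le_antisymm this (sq_nonneg e))
    rw [he0] at hd
    linarith
  · intro h s
    rw [h]
    nlinarith [mul_nonneg hG (sq_nonneg (s - t))]

theorem isMaxLikelihood_normalDensity_iff {ι : Type*} [Fintype ι] [DecidableEq ι]
    {R : Matrix ι ι ℝ} (hR : R.PosDef) (y : ι → ℝ) (t : ℝ) :
    IsMaxLikelihood (fun s => normalDensity (fun _ => s) R y) t ↔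
      (R⁻¹.mulVec 1) ⬝ᵥ y = ((R⁻¹.mulVec 1) ⬝ᵥ 1) * t := by
  have hP := hR.inv
  have hT : R⁻¹.transpose = R⁻¹ := by
    have := hP.isHermitian
    rwa [Matrix.IsHermitian, Matrix.conjTranspose_eq_transpose_of_trivial] at this
  have hsymm : ∀ a b : ι → ℝ, a ⬝ᵥ R⁻¹.mulVec b = (R⁻¹.mulVec a) ⬝ᵥ b := by
    intro a b
    rw [Matrix.dotProduct_mulVec, ← Matrix.mulVec_transpose, hT]
  refine isMaxLikelihood_iff_of_eq_exp_quadratic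
    (c := (Real.sqrt ((2 * Real.pi) ^ Fintype.card ι * R.det))⁻¹) (A := y ⬝ᵥ R⁻¹.mulVec y)
    ?_ ?_ (fun s => ?_) t
  · have := hR.det_pos
    have := Real.pi_pos
    positivity
  · rw [dotProduct_comm]
    simpa using hP.posSemidef.dotProduct_mulVec_nonneg 1
  · unfold normalDensity
    congr 3
    have h1 : (fun _ : ι => s) = s • (1 : ι → ℝ) := by ext; simp
    rw [h1, Matrix.mulVec_sub, Matrix.mulVec_smul, sub_dotProduct, dotProduct_sub, dotProduct_sub,
      smul_dotProduct, smul_dotProduct, dotProduct_smul, dotProduct_smul, hsymm 1 y,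
      dotProduct_comm y, dotProduct_comm 1, dotProduct_comm y (R⁻¹.mulVec 1)]
    simp only [smul_eq_mul]
    ring

theorem isIdealEstimate_iff {L₁ : ℕ} {v : Fin L₁ → ℝ≥0} (hv : ∀ i, 0 < v i) (x : Fin L₁ → ℝ)
    (t : ℝ) :
    IsIdealEstimate v x t ↔ ∑ i, (v i : ℝ)⁻¹ * x i = (∑ i, (v i : ℝ)⁻¹) * t := by
  refine isMaxLikelihood_iff_of_eq_exp_quadratic
    (c := ∏ i, (√(2 * Real.pi * (v i : ℝ)))⁻¹) (A := ∑ i, (v i : ℝ)⁻¹ * x i ^ 2)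
    ?_ ?_ (fun s => ?_) t
  · refine Finset.prod_pos fun i _ => ?_
    have : (0 : ℝ) < v i := hv i
    have := Real.pi_pos
    positivity
  · positivity
  · simp only [ProbabilityTheory.gaussianPDFReal]
    rw [Finset.prod_mul_distrib, ← Real.exp_sum]
    congr 2
    rw [Finset.mul_sum, Finset.sum_mul, Finset.sum_mul, ← Finset.sum_sub_distrib,
      ← Finset.sum_add_distrib, ← Finset.sum_neg_distrib, Finset.sum_div]
    refine Finset.sum_congr rfl fun i _ => ?_
    have : (v i : ℝ) ≠ 0 := by exact_mod_cast (hv i).ne'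
    field_simp
    ring

/-! ### Ideal networks and the row span of the connection matrix -/

/-- The real `0`-`1` vector with the entries of `r`. -/
def boolVec {β : Type*} (r : β → Bool) : β → ℝ := fun j => if r j = true then 1 else 0

section Network

variable {L₁ L₂ : ℕ} {v : Fin L₁ → ℝ≥0} {C : Fin L₂ → Fin L₁ → Bool}

/-- The total precision received by the second-layer agent `i`. -/
def receivedPrecision (v : Fin L₁ → ℝ≥0) (C : Fin L₂ → Fin L₁ → Bool) (i : Fin L₂) : ℝ :=
  ∑ k with C i k = true, (v k : ℝ)⁻¹

theorem secondLayerWeights_apply (i : Fin L₂) (j : Fin L₁) :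
    secondLayerWeights v C i j =
      (receivedPrecision v C i)⁻¹ * (boolVec (C i) j * (v j : ℝ)⁻¹) := by
  simp only [secondLayerWeights, Matrix.of_apply, boolVec, receivedPrecision]
  split_ifs
  · rw [one_mul, div_eq_inv_mul]
  · simp

theorem receivedPrecision_pos (hv : ∀ i, 0 < v i) {i : Fin L₂} {j : Fin L₁} (h : C i j = true) :
    0 < receivedPrecision v C i := by
  refine Finset.sum_pos (fun k _ => inv_pos.2 (by exact_mod_cast hv k)) ⟨j, by simpa using h⟩

theorem receivedPrecision_mul_secondLayerWeights (hv : ∀ i, 0 < v i) (i : Fin L₂) (j : Fin L₁) :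
    receivedPrecision v C i * secondLayerWeights v C i j = boolVec (C i) j * (v j : ℝ)⁻¹ := by
  rw [secondLayerWeights_apply]
  by_cases h : C i j = true
  · have := (receivedPrecision_pos hv h).ne'
    field_simp
  · simp [boolVec, h]

/-- The precision vector is in the span of the second-layer weights if and only if the all-ones
vector is in the span of the rows of the connection matrix: the weights are the connections, up to
an invertible scaling of the columns and a scaling of the nonzero rows. -/
theorem precision_mem_span_iff (hv : ∀ i, 0 < v i) :
    (fun j => (v j : ℝ)⁻¹) ∈ Submodule.span ℝ (Set.range (secondLayerWeights v C)) ↔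
      (1 : Fin L₁ → ℝ) ∈ Submodule.span ℝ (Set.range fun i => boolVec (C i)) := by
  refine (Submodule.mem_span_range_iff_exists_fun ℝ).trans
    (Iff.trans ?_ (Submodule.mem_span_range_iff_exists_fun ℝ).symm)
  constructor
  · rintro ⟨a, ha⟩
    refine ⟨fun i => a i * (receivedPrecision v C i)⁻¹, funext fun j => ?_⟩
    have hj := congr_fun ha j
    have hvj : (v j : ℝ) ≠ 0 := by exact_mod_cast (hv j).ne'
    simp only [Finset.sum_apply, Pi.smul_apply, smul_eq_mul, secondLayerWeights_apply,
      Pi.one_apply] at hj ⊢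
    have hj' := congrArg (fun z => z * (v j : ℝ)) hj
    simp only [Finset.sum_mul, inv_mul_cancel₀ hvj] at hj'
    rw [← hj']
    refine Finset.sum_congr rfl fun i _ => ?_
    field_simp
  · rintro ⟨a, ha⟩
    refine ⟨fun i => a i * receivedPrecision v C i, funext fun j => ?_⟩
    have hj := congr_fun ha j
    simp only [Finset.sum_apply, Pi.smul_apply, smul_eq_mul, Pi.one_apply] at hj ⊢
    simp only [mul_assoc, receivedPrecision_mul_secondLayerWeights hv]
    simp only [← mul_assoc]
    rw [← Finset.sum_mul, hj, one_mul]

/-- The weights of the agents in `S`. -/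
def retainedWeights (v : Fin L₁ → ℝ≥0) (C : Fin L₂ → Fin L₁ → Bool) (S : Finset (Fin L₂)) :
    Matrix S (Fin L₁) ℝ :=
  (secondLayerWeights v C).submatrix (fun i => (i : Fin L₂)) id

theorem retainedCovariance_eq (S : Finset (Fin L₂)) :
    retainedCovariance v C S = retainedWeights v C S * Matrix.diagonal (fun j => (v j : ℝ)) *
      (retainedWeights v C S).conjTranspose := by
  ext i j
  simp [retainedCovariance, secondLayerCovariance, retainedWeights, Matrix.mul_apply,
    Matrix.conjTranspose_eq_transpose_of_trivial]

theorem range_retainedWeights (S : Finset (Fin L₂)) :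
    Set.range (retainedWeights v C S) = secondLayerWeights v C '' (S : Set (Fin L₂)) := by
  ext w
  constructor
  · rintro ⟨i, rfl⟩
    exact ⟨i, i.2, rfl⟩
  · rintro ⟨i, hi, rfl⟩
    exact ⟨⟨i, hi⟩, rfl⟩

theorem posDef_retainedCovariance_of_isUnit {S : Finset (Fin L₂)}
    (h : IsUnit (retainedCovariance v C S)) : (retainedCovariance v C S).PosDef := by
  refine (Matrix.PosSemidef.posDef_iff_isUnit ?_).2 h
  rw [retainedCovariance_eq]
  exact (Matrix.PosSemidef.diagonal fun j => (v j).2).mul_mul_conjTranspose_same _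

theorem exists_isRetained (hv : ∀ i, 0 < v i) (C : Fin L₂ → Fin L₁ → Bool) :
    ∃ S, IsRetained v C S := by
  classical
  obtain ⟨b, -, -, hspan, hli⟩ := exists_linearIndepOn_extension
    (K := ℝ) (v := secondLayerWeights v C) (linearIndepOn_empty ℝ _) (Set.empty_subset Set.univ)
  refine ⟨b.toFinset, ?_, fun i => ?_⟩
  · rw [retainedCovariance_eq]
    refine Matrix.PosDef.isUnit (Matrix.PosDef.mul_mul_conjTranspose_same
      (Matrix.PosDef.diagonal fun j => by exact_mod_cast hv j) ?_)
    rw [Matrix.vecMul_injective_iff]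
    have h2 : LinearIndepOn ℝ (secondLayerWeights v C) (b.toFinset : Set (Fin L₂)) := by
      simpa using hli
    exact h2
  · simpa using hspan ⟨i, Set.mem_univ i, rfl⟩

/-- A retained agent receives a measurement: a zero row of weights would make the covariance matrix
singular. -/
theorem exists_connection_of_isUnit {S : Finset (Fin L₂)}
    (h : IsUnit (retainedCovariance v C S)) (i : S) : ∃ j, C i j = true := by
  by_contra! hC
  obtain ⟨P, hP⟩ := h.exists_right_inv
  have h1 := congr_fun (congr_fun hP i) i
  have h0 : ∀ j, retainedWeights v C S i j = 0 := fun j => by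
    simp [retainedWeights, secondLayerWeights_apply, boolVec, hC j]
  rw [retainedCovariance_eq, Matrix.mul_assoc, Matrix.mul_assoc, Matrix.mul_apply] at h1
  simp [h0] at h1

theorem retainedWeights_mulVec_one (hv : ∀ i, 0 < v i) {S : Finset (Fin L₂)}
    (h : IsUnit (retainedCovariance v C S)) : (retainedWeights v C S).mulVec 1 = 1 := by
  ext i
  obtain ⟨j, hj⟩ := exists_connection_of_isUnit h i
  have hpos := receivedPrecision_pos hv hj
  simp only [Matrix.mulVec, dotProduct, retainedWeights, Matrix.submatrix_apply,
    secondLayerWeights_apply, id, Pi.one_apply, mul_one]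
  rw [← Finset.mul_sum, inv_mul_eq_one₀ hpos.ne', receivedPrecision, Finset.sum_filter]
  simp [boolVec]

theorem isFinalEstimate_iff {x : Fin L₁ → ℝ} {t : ℝ} :
    IsFinalEstimate v C x t ↔ ∃ S, IsRetained v C S ∧
      ((retainedCovariance v C S)⁻¹.mulVec 1) ⬝ᵥ ((retainedWeights v C S).mulVec x) =
        (((retainedCovariance v C S)⁻¹.mulVec 1) ⬝ᵥ 1) * t := by
  refine exists_congr fun S => and_congr_right fun hS => ?_
  exact isMaxLikelihood_normalDensity_iff (posDef_retainedCovariance_of_isUnit hS.1) _ t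

/-- The Gauss-Markov theorem for the network: if the all-ones vector is a linear combination
`a` of the rows of the connection matrix, then `a`, suitably scaled, solves the normal equations
`R a = 1` of the final agent, so that the final estimate is the ideal one. -/
theorem isIdealNetwork_of_one_mem_span (hv : ∀ i, 0 < v i)
    (h : (1 : Fin L₁ → ℝ) ∈ Submodule.span ℝ (Set.range fun i => boolVec (C i))) :
    IsIdealNetwork v C := by
  have key : ∀ S, IsRetained v C S → ∀ (x : Fin L₁ → ℝ) (t : ℝ),
      (((retainedCovariance v C S)⁻¹.mulVec 1) ⬝ᵥ ((retainedWeights v C S).mulVec x) =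
        (((retainedCovariance v C S)⁻¹.mulVec 1) ⬝ᵥ 1) * t ↔ IsIdealEstimate v x t) := by
    intro S hS x t
    have hone := retainedWeights_mulVec_one hv hS.1
    rw [← precision_mem_span_iff hv] at h
    have hw : (fun j => (v j : ℝ)⁻¹) ∈ Submodule.span ℝ (Set.range (retainedWeights v C S)) := by
      rw [range_retainedWeights]
      refine Submodule.span_le.2 ?_ h
      rintro _ ⟨i, rfl⟩
      exact hS.2 i
    obtain ⟨a, ha⟩ := (Submodule.mem_span_range_iff_exists_fun ℝ).1 hw
    have ha' : Matrix.vecMul a (retainedWeights v C S) = fun j => (v j : ℝ)⁻¹ := by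
      rw [← ha]
      ext j
      simp [Matrix.vecMul, dotProduct]
    have hRa : (retainedCovariance v C S).mulVec a = 1 := by
      rw [retainedCovariance_eq, ← Matrix.mulVec_mulVec, ← Matrix.mulVec_mulVec,
        Matrix.conjTranspose_eq_transpose_of_trivial, Matrix.mulVec_transpose, ha', ← hone]
      congr 1
      ext j
      have hvj : (v j : ℝ) ≠ 0 := by exact_mod_cast (hv j).ne'
      simp [Matrix.mulVec_diagonal, hvj]
    have hinv : (retainedCovariance v C S)⁻¹.mulVec 1 = a := by
      rw [← hRa, Matrix.mulVec_mulVec,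
        Matrix.nonsing_inv_mul _ ((Matrix.isUnit_iff_isUnit_det _).1 hS.1), Matrix.one_mulVec]
    have hsum : a ⬝ᵥ 1 = ∑ i, (v i : ℝ)⁻¹ := by
      rw [← hone, Matrix.dotProduct_mulVec, ha']
      simp [dotProduct]
    rw [hinv, hsum, Matrix.dotProduct_mulVec, ha', isIdealEstimate_iff hv]
    rfl
  intro x t
  rw [isFinalEstimate_iff]
  constructor
  · rintro ⟨S, hS, h1⟩
    exact (key S hS x t).1 h1
  · intro h1
    obtain ⟨S, hS⟩ := exists_isRetained hv C
    exact ⟨S, hS, (key S hS x t).2 h1⟩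

/-- The final estimate is a linear combination of the second-layer estimates; if it is ideal, the
precision vector, which gives the ideal estimate, is a combination of the second-layer weights. -/
theorem one_mem_span_of_isIdealNetwork (hL : 0 < L₁) (hv : ∀ i, 0 < v i)
    (h : IsIdealNetwork v C) :
    (1 : Fin L₁ → ℝ) ∈ Submodule.span ℝ (Set.range fun i => boolVec (C i)) := by
  obtain ⟨S, hS⟩ := exists_isRetained hv C
  set b := (retainedCovariance v C S)⁻¹.mulVec 1 with hb
  have h1 : ∀ x t, b ⬝ᵥ ((retainedWeights v C S).mulVec x) = (b ⬝ᵥ 1) * t →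
      ∑ i, (v i : ℝ)⁻¹ * x i = (∑ i, (v i : ℝ)⁻¹) * t := fun x t hx => by
    rw [← isIdealEstimate_iff hv, ← h, isFinalEstimate_iff]
    exact ⟨S, hS, hx⟩
  have hG : 0 < ∑ i, (v i : ℝ)⁻¹ :=
    Finset.sum_pos (fun k _ => inv_pos.2 (by exact_mod_cast hv k)) ⟨⟨0, hL⟩, Finset.mem_univ _⟩
  have hβ : b ⬝ᵥ 1 ≠ 0 := by
    intro h0
    have := h1 0 1 (by simp [h0])
    simp at this
    exact hG.ne this
  rw [← precision_mem_span_iff hv]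
  have h2 : (fun j => (v j : ℝ)⁻¹) =
      ((∑ i, (v i : ℝ)⁻¹) * (b ⬝ᵥ 1)⁻¹) • Matrix.vecMul b (retainedWeights v C S) := by
    ext j
    have := h1 (Pi.single j 1) ((b ⬝ᵥ 1)⁻¹ * Matrix.vecMul b (retainedWeights v C S) j) (by
      rw [Matrix.dotProduct_mulVec, dotProduct_single]
      field_simp)
    simp only [Pi.single_apply, mul_ite, mul_one, mul_zero, Finset.sum_ite_eq',
      Finset.mem_univ, if_true] at this
    rw [this, Pi.smul_apply, smul_eq_mul, mul_assoc]
  rw [h2]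
  refine Submodule.smul_mem _ _ (Submodule.span_mono (s := Set.range (retainedWeights v C S)) ?_ ?_)
  · rintro _ ⟨i, rfl⟩
    exact ⟨i, rfl⟩
  · refine (Submodule.mem_span_range_iff_exists_fun ℝ).2 ⟨b, ?_⟩
    ext j
    simp [Matrix.vecMul, dotProduct]

end Network

/-! ### Uniform probability on finite types -/

/-- The probability of `S` under the uniform law on the finite type `X`. -/
def density {X : Type*} (S : Set X) : ℝ := S.ncard / Nat.card X

section Density

theorem density_nonneg {X : Type*} (S : Set X) : 0 ≤ density S := by
  unfold density; positivity

theorem density_union_le {X : Type*} (S T : Set X) :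
    density (S ∪ T) ≤ density S + density T := by
  unfold density
  rw [← add_div]
  have := Set.ncard_union_le S T
  gcongr
  exact_mod_cast this

theorem density_forall_mem {ι X : Type*} [Finite ι] (G : Set X) :
    density {f : ι → X | ∀ i, f i ∈ G} = density G ^ Nat.card ι := by
  have := Fintype.ofFinite ι
  have h : {f : ι → X | ∀ i, f i ∈ G}.ncard = G.ncard ^ Nat.card ι := by
    rw [← Nat.card_coe_set_eq, ← Nat.card_coe_set_eq, ← Nat.card_fun]
    exact Nat.card_congr (Equiv.subtypePiEquivPi (p := fun _ x => x ∈ G))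
  unfold density
  rw [h, Nat.card_fun, div_pow]
  push_cast
  rfl

variable {X Y : Type*} [Finite X] [Finite Y]

theorem density_mono {S T : Set X} (h : S ⊆ T) : density S ≤ density T := by
  unfold density
  have := Set.ncard_le_ncard h
  gcongr

theorem density_le_one (S : Set X) : density S ≤ 1 := by
  unfold density
  refine div_le_one_of_le₀ ?_ (by positivity)
  exact_mod_cast Set.ncard_le_card S

theorem density_compl [Nonempty X] (S : Set X) : density Sᶜ = 1 - density S := by
  have h := Set.ncard_add_ncard_compl S
  have hX : (Nat.card X : ℝ) ≠ 0 := by exact_mod_cast Nat.card_pos.ne'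
  unfold density
  rw [eq_sub_iff_add_eq, ← add_div, div_eq_one_iff_eq hX]
  exact_mod_cast (add_comm _ _).trans h

open scoped Classical in
theorem ncard_eq_sum_indicator {X : Type*} [Fintype X] (S : Set X) :
    (S.ncard : ℝ) = ∑ x, if x ∈ S then 1 else 0 := by
  rw [Finset.sum_boole, Set.ncard_eq_toFinset_card', Set.filter_mem_univ_eq_toFinset]

/-- If every slice of `S` over a point outside `N` has probability at most `c`, then `S` has
probability at most that of `N`, plus `c`. -/
theorem density_le_of_slices {Z : Type*} [Finite Z] (e : Z ≃ X × Y) {S : Set Z} (N : Set X)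
    {c : ℝ} (hc : 0 ≤ c) (h : ∀ a ∉ N, density {b | e.symm (a, b) ∈ S} ≤ c) :
    density S ≤ density N + c := by
  classical
  have := Fintype.ofFinite X
  have := Fintype.ofFinite Y
  have := Fintype.ofFinite Z
  rcases isEmpty_or_nonempty Z with hZ | hZ
  · have h0 : density S = 0 := by simp [density, Set.eq_empty_of_isEmpty S]
    rw [h0]
    exact add_nonneg (density_nonneg N) hc
  have hne : Nonempty (X × Y) := e.nonempty_congr.1 hZ
  have hX : 0 < (Nat.card X : ℝ) := by
    have : Nonempty X := hne.map Prod.fst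
    exact_mod_cast Nat.card_pos
  have hY : 0 < (Nat.card Y : ℝ) := by
    have : Nonempty Y := hne.map Prod.snd
    exact_mod_cast Nat.card_pos
  have hcard : (Nat.card Z : ℝ) = Nat.card X * Nat.card Y := by
    rw [Nat.card_congr e, Nat.card_prod]; push_cast; ring
  have hsum : (S.ncard : ℝ) = ∑ a, ({b | e.symm (a, b) ∈ S}.ncard : ℝ) := by
    rw [ncard_eq_sum_indicator, ← e.symm.sum_comp, Fintype.sum_prod_type]
    refine Finset.sum_congr rfl fun a _ => ?_
    rw [ncard_eq_sum_indicator]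
    rfl
  have hslice : ∀ a, ({b | e.symm (a, b) ∈ S}.ncard : ℝ) ≤
      (if a ∈ N then 1 else 0) * Nat.card Y + c * Nat.card Y := by
    intro a
    by_cases ha : a ∈ N
    · have h1 : ({b | e.symm (a, b) ∈ S}.ncard : ℝ) ≤ Nat.card Y := by
        exact_mod_cast Set.ncard_le_card _
      rw [if_pos ha, one_mul]
      nlinarith
    · have h1 := h a ha
      rw [density, div_le_iff₀ hY] at h1
      rw [if_neg ha]
      linarith
  have htot : (S.ncard : ℝ) ≤ N.ncard * Nat.card Y + Nat.card X * (c * Nat.card Y) := by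
    rw [hsum]
    refine (Finset.sum_le_sum fun a _ => hslice a).trans_eq ?_
    rw [Finset.sum_add_distrib, ← Finset.sum_mul, ← ncard_eq_sum_indicator]
    simp
  unfold density
  rw [hcard, div_le_iff₀ (by positivity)]
  refine htot.trans_eq ?_
  field_simp

theorem density_biUnion_le {ι : Type*} (s : Finset ι) (E : ι → Set X) {c : ℝ}
    (h : ∀ i ∈ s, density (E i) ≤ c) : density {x | ∃ i ∈ s, x ∈ E i} ≤ s.card * c := by
  classical
  induction s using Finset.induction_on with
  | empty => simp [density]
  | insert i s hi ih =>
    have hsub : {x | ∃ k ∈ insert i s, x ∈ E k} ⊆ E i ∪ {x | ∃ k ∈ s, x ∈ E k} := by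
      rintro x ⟨k, hk, hx⟩
      rcases Finset.mem_insert.1 hk with rfl | hk
      · exact Or.inl hx
      · exact Or.inr ⟨k, hk, hx⟩
    have h1 := h i (Finset.mem_insert_self _ _)
    have h2 := ih fun k hk => h k (Finset.mem_insert_of_mem hk)
    rw [Finset.card_insert_of_notMem hi]
    push_cast
    linarith [density_mono hsub, density_union_le (E i) {x | ∃ k ∈ s, x ∈ E k}]

/-- Markov's inequality for the number of events that occur. -/
theorem mul_density_le_sum {ι : Type*} [Fintype ι] (E : ι → Set X) {S : Set X} (k : ℕ)
    (h : ∀ x ∈ S, k ≤ {i | x ∈ E i}.ncard) : k * density S ≤ ∑ i, density (E i) := by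
  classical
  have := Fintype.ofFinite X
  unfold density
  rw [← mul_div_assoc, ← Finset.sum_div]
  gcongr
  simp only [ncard_eq_sum_indicator]
  rw [Finset.sum_comm, Finset.mul_sum]
  refine Finset.sum_le_sum fun x _ => ?_
  have h1 : (({i | x ∈ E i}.ncard : ℕ) : ℝ) = ∑ i, if x ∈ E i then 1 else 0 :=
    ncard_eq_sum_indicator _
  rw [← h1]
  split_ifs with hx
  · rw [mul_one]
    exact_mod_cast h x hx
  · rw [mul_zero]
    positivity

/-- A surjective homomorphism of finite groups maps the uniform law to the uniform law. -/
theorem density_preimage_of_surjective {G H : Type*} [AddGroup G] [AddGroup H] [Finite G]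
    [Finite H] (f : G →+ H) (hf : Function.Surjective f) (S : Set H) :
    density (f ⁻¹' S) = density S := by
  classical
  have := Fintype.ofFinite G
  have := Fintype.ofFinite H
  have hfib : ∀ y : H, (∑ x, if f x = y then (1 : ℝ) else 0) =
      ∑ x, if f x = 0 then (1 : ℝ) else 0 := by
    intro y
    rw [Finset.sum_boole, Finset.sum_boole]
    exact_mod_cast AddMonoidHom.card_fiber_eq_of_mem_range f (hf y) (hf 0)
  have hcount : ∀ T : Set H, ((f ⁻¹' T).ncard : ℝ) =
      T.ncard * ∑ x, if f x = 0 then (1 : ℝ) else 0 := by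
    intro T
    have hT : ∀ y : H, (if y ∈ T then (1 : ℝ) else 0) * (∑ x, if f x = 0 then (1 : ℝ) else 0) =
        ∑ x, (if y ∈ T then (1 : ℝ) else 0) * if f x = y then (1 : ℝ) else 0 := fun y => by
      rw [← hfib y, Finset.mul_sum]
    rw [ncard_eq_sum_indicator, ncard_eq_sum_indicator, Finset.sum_mul,
      Finset.sum_congr rfl fun y _ => hT y, Finset.sum_comm]
    refine Finset.sum_congr rfl fun x _ => ?_
    simp
  have huniv := hcount Set.univ
  rw [Set.preimage_univ, Set.ncard_univ, Set.ncard_univ] at huniv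
  have hne : (∑ x, if f x = 0 then (1 : ℝ) else 0) ≠ 0 := by
    intro h0
    rw [h0, mul_zero] at huniv
    exact Nat.card_pos.ne' (by exact_mod_cast huniv : Nat.card G = 0)
  unfold density
  rw [hcount, huniv, mul_div_mul_right _ _ hne]

end Density

/-! ### The Littlewood–Offord inequality -/

theorem ncard_dotProduct_boolVec_eq_le {ι : Type*} [Fintype ι] (u : ι → ℝ) (hu : ∀ i, u i ≠ 0)
    (a : ℝ) : {r : ι → Bool | u ⬝ᵥ boolVec r = a}.ncard ≤
      (Fintype.card ι).choose (Fintype.card ι / 2) := by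
  classical
  -- complementing the coordinates with a negative coefficient makes the sum monotone
  let F : (ι → Bool) → Finset ι := fun r => {i | (r i = true ↔ 0 < u i)}
  have hF : Function.Injective F := by
    intro r s h
    ext i
    have hi : i ∈ F r ↔ i ∈ F s := by rw [h]
    simp only [F, Finset.mem_filter, Finset.mem_univ, true_and] at hi
    by_cases h0 : 0 < u i <;> cases hr : r i <;> cases hs : s i <;> simp_all
  have hmono : ∀ r s, F r ⊆ F s → u ⬝ᵥ boolVec r = u ⬝ᵥ boolVec s → r = s := by
    intro r s h heq
    have hle : ∀ i ∈ Finset.univ, u i * boolVec r i ≤ u i * boolVec s i := by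
      intro i _
      have hi : i ∈ F r → i ∈ F s := fun hi => h hi
      simp only [F, Finset.mem_filter, Finset.mem_univ, true_and] at hi
      rcases (hu i).lt_or_gt with h0 | h0
      · have h1 : ¬ 0 < u i := h0.not_gt
        cases hr : r i <;> cases hs : s i <;> simp_all [boolVec]
      · cases hr : r i <;> cases hs : s i <;> simp_all [boolVec]
        linarith
    have := (Finset.sum_eq_sum_iff_of_le hle).1 heq
    ext i
    have hi := mul_left_cancel₀ (hu i) (this i (Finset.mem_univ i))
    cases hr : r i <;> cases hs : s i <;> simp_all [boolVec]
  let 𝒜 : Finset (Finset ι) := Finset.image F {r | u ⬝ᵥ boolVec r = a}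
  have hanti : IsAntichain (· ⊆ ·) (𝒜 : Set (Finset ι)) := by
    intro A hA B hB hne hsub
    obtain ⟨r, hr, rfl⟩ := Finset.mem_image.1 hA
    obtain ⟨s, hs, rfl⟩ := Finset.mem_image.1 hB
    rw [Finset.mem_filter] at hr hs
    exact hne (congrArg F (hmono r s hsub (hr.2.trans hs.2.symm)))
  have hcard := hanti.sperner
  rw [Finset.card_image_of_injective _ hF] at hcard
  rw [Set.ncard_eq_toFinset_card']
  simpa using hcard

/-- The Littlewood–Offord inequality for random subset sums, in Erdős's form. -/
theorem density_dotProduct_boolVec_eq_le {β : Type*} [Fintype β] (u : β → ℝ) (T : Finset β)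
    (hT : ∀ j ∈ T, u j ≠ 0) (a : ℝ) :
    density {r : β → Bool | u ⬝ᵥ boolVec r = a} ≤ (T.card.choose (T.card / 2) : ℝ) / 2 ^ T.card := by
  classical
  have h := density_le_of_slices
    ((Equiv.piEquivPiSubtypeProd (· ∈ T) (fun _ : β => Bool)).trans (Equiv.prodComm _ _))
    (S := {r : β → Bool | u ⬝ᵥ boolVec r = a}) ∅
    (c := (T.card.choose (T.card / 2) : ℝ) / 2 ^ T.card) (by positivity) ?_
  · simpa [density] using h
  intro s _
  unfold density
  have hc : (Nat.card ({j // j ∈ T} → Bool) : ℝ) = 2 ^ T.card := by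
    simp [Nat.card_eq_fintype_card]
  rw [hc]
  gcongr
  have h1 := ncard_dotProduct_boolVec_eq_le (fun j : {j // j ∈ T} => u j) (fun j => hT j j.2)
    (a - (fun j : {j // j ∉ T} => u j) ⬝ᵥ boolVec s)
  rw [Fintype.card_coe] at h1
  refine le_trans (le_of_eq ?_) h1
  congr 1
  ext r
  simp only [Set.mem_ofPred_eq]
  rw [eq_sub_iff_add_eq]
  refine iff_of_eq (congrArg (· = a) ?_)
  simp only [dotProduct]
  rw [← Fintype.sum_subtype_add_sum_subtype (· ∈ T)]
  congr 1 <;> refine Finset.sum_congr (Finset.ext fun _ => by simp) fun j _ => ?_ <;>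
    simp [boolVec, j.2]

theorem density_dotProduct_boolVec_eq_zero_le_half {β : Type*} [Fintype β] {u : β → ℝ}
    (hu : u ≠ 0) : density {r : β → Bool | u ⬝ᵥ boolVec r = 0} ≤ 1 / 2 := by
  obtain ⟨j, hj⟩ := Function.ne_iff.1 hu
  simpa using density_dotProduct_boolVec_eq_le u {j} (by simpa using hj) 0

theorem centralBinom_sq_mul_le (m : ℕ) : (Nat.centralBinom m) ^ 2 * (2 * m + 1) ≤ 16 ^ m := by
  induction m with
  | zero => simp
  | succ m ih =>
    have h := Nat.succ_mul_centralBinom_succ m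
    have h1 : (m + 1) ^ 2 * (Nat.centralBinom (m + 1) ^ 2 * (2 * (m + 1) + 1)) =
        4 * (2 * m + 1) * (2 * m + 3) * (Nat.centralBinom m ^ 2 * (2 * m + 1)) := by
      calc _ = ((m + 1) * Nat.centralBinom (m + 1)) ^ 2 * (2 * (m + 1) + 1) := by ring
        _ = _ := by rw [h]; ring
    have h2 : 4 * (2 * m + 1) * (2 * m + 3) ≤ (m + 1) ^ 2 * 16 := by nlinarith
    refine le_of_mul_le_mul_left (a := (m + 1) ^ 2) ?_ (pow_pos m.succ_pos 2)
    rw [h1]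
    calc _ ≤ (m + 1) ^ 2 * 16 * 16 ^ m := Nat.mul_le_mul h2 ih
      _ = _ := by ring

theorem choose_half_div_two_pow_le {m : ℕ} (hm : 0 < m) :
    ((2 * m).choose (2 * m / 2) : ℝ) / 2 ^ (2 * m) ≤ 1 / √(2 * m : ℝ) := by
  have h : ((Nat.centralBinom m : ℝ)) ^ 2 * (2 * m + 1) ≤ 16 ^ m := by
    exact_mod_cast centralBinom_sq_mul_le m
  have hm' : (0 : ℝ) < m := by exact_mod_cast hm
  rw [Nat.mul_div_cancel_left m two_pos, ← Nat.centralBinom_eq_two_mul_choose,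
    div_le_div_iff₀ (by positivity) (Real.sqrt_pos.2 (by linarith)), one_mul]
  refine abs_le_of_sq_le_sq' ?_ (by positivity) |>.2
  rw [mul_pow, Real.sq_sqrt (by positivity), ← pow_mul]
  have h16 : (2 : ℝ) ^ (2 * m * 2) = 16 ^ m := by
    rw [mul_right_comm, pow_mul]; norm_num
  rw [h16]
  nlinarith [sq_nonneg (Nat.centralBinom m : ℝ)]

/-! ### Random matrices with a sparse null vector -/

/-- The Boolean matrices whose rows, read as real vectors, are all orthogonal to a common nonzero
vector supported on at most `k` coordinates (on a set of exactly `k` coordinates, which is the same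
when there are at least `k`). -/
def sparseNull (α β : Type*) [Fintype β] (k : ℕ) : Set (α → β → Bool) :=
  {C | ∃ T : Finset β, T.card = k ∧ ∃ w : β → ℝ, w ≠ 0 ∧ (∀ j ∉ T, w j = 0) ∧
    ∀ i, w ⬝ᵥ boolVec (C i) = 0}

theorem exists_ne_zero_dotProduct_eq_zero {ι β : Type*} [Fintype ι] [Fintype β] (f : ι → β → ℝ)
    (T : Finset β) (h : Fintype.card ι < T.card) :
    ∃ w : β → ℝ, w ≠ 0 ∧ (∀ j ∉ T, w j = 0) ∧ ∀ i, w ⬝ᵥ f i = 0 := by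
  classical
  have hker := LinearMap.ker_ne_bot_of_finrank_lt
    (f := (Matrix.of fun (i : ι) (j : T) => f i j).mulVecLin) (by simpa using h)
  obtain ⟨u, hu, hu0⟩ := Submodule.exists_mem_ne_zero_of_ne_bot hker
  refine ⟨fun j => if h : j ∈ T then u ⟨j, h⟩ else 0, ?_, fun j hj => by simp [hj], fun i => ?_⟩
  · obtain ⟨j, hj⟩ := Function.ne_iff.1 hu0
    refine Function.ne_iff.2 ⟨j, ?_⟩
    simpa using hj
  · have h1 := congr_fun (LinearMap.mem_ker.1 hu) i
    simp only [Matrix.mulVecLin_apply, Matrix.mulVec, dotProduct, Matrix.of_apply,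
      Pi.zero_apply] at h1
    rw [dotProduct, ← Finset.sum_subset (Finset.subset_univ T) (fun j _ hj => by simp [hj]),
      ← Finset.sum_coe_sort, ← h1]
    refine Finset.sum_congr rfl fun j _ => ?_
    simp [mul_comm]

theorem dotProduct_eq_sum_subtype {β : Type*} [Fintype β] {T : Finset β} {w : β → ℝ}
    (hw : ∀ j ∉ T, w j = 0) (x : β → ℝ) :
    w ⬝ᵥ x = (fun j : T => w j) ⬝ᵥ (fun j : T => x j) := by
  simp only [dotProduct]
  rw [Finset.sum_coe_sort T (fun j => w j * x j)]
  exact (Finset.sum_subset (Finset.subset_univ T) fun j _ hj => by simp [hw j hj]).symm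

/-- If all rows are orthogonal to a nonzero vector supported on `T`, then fewer than `#T` rows span
the restrictions of all rows to `T`. -/
theorem exists_spanning_rows {α β : Type*} [Fintype α] [Fintype β] {m : ℕ}
    (hm : m ≤ Fintype.card α) (f : α → β → ℝ) {T : Finset β} (hT : T.card = m + 1) {w : β → ℝ}
    (hw : w ≠ 0) (hwT : ∀ j ∉ T, w j = 0) (h : ∀ i, w ⬝ᵥ f i = 0) :
    ∃ B : Finset α, B.card = m ∧ ∀ u : β → ℝ, (∀ j ∉ T, u j = 0) →
      (∀ i ∈ B, u ⬝ᵥ f i = 0) → ∀ i, u ⬝ᵥ f i = 0 := by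
  classical
  let x : α → T → ℝ := fun i j => f i j
  obtain ⟨b, -, -, hspan, hli⟩ := exists_linearIndepOn_extension
    (K := ℝ) (v := x) (linearIndepOn_empty ℝ _) (Set.empty_subset Set.univ)
  have hann : ∀ u : β → ℝ, (∀ j ∉ T, u j = 0) → (∀ i ∈ b, u ⬝ᵥ f i = 0) →
      ∀ y ∈ Submodule.span ℝ (x '' b), (fun j : T => u j) ⬝ᵥ y = 0 := by
    intro u hu hub y hy
    induction hy using Submodule.span_induction with
    | mem y hy =>
      obtain ⟨i, hi, rfl⟩ := hy
      rw [← hub i hi, dotProduct_eq_sum_subtype hu]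
    | zero => simp
    | add y z _ _ hy hz => rw [dotProduct_add, hy, hz, add_zero]
    | smul c y _ hy => rw [dotProduct_smul, hy, smul_zero]
  have hlt : Submodule.span ℝ (x '' b) < ⊤ := by
    refine lt_top_iff_ne_top.2 fun htop => hw ?_
    have h0 := hann w hwT (fun i _ => h i) (fun j => w j) (htop ▸ Submodule.mem_top)
    rw [dotProduct_self_eq_zero] at h0
    ext j
    by_cases hj : j ∈ T
    · exact congr_fun h0 ⟨j, hj⟩
    · exact hwT j hj
  have hcard : b.toFinset.card ≤ m := by
    have h1 := Submodule.finrank_lt hlt.ne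
    have h2 := finrank_span_eq_card (R := ℝ) hli
    rw [← Set.image_eq_range, ← Set.toFinset_card] at h2
    rw [h2, Module.finrank_fintype_fun_eq_card, Fintype.card_coe, hT] at h1
    omega
  obtain ⟨B, hbB, hB⟩ := Finset.exists_superset_card_eq hcard hm
  refine ⟨B, hB, fun u hu huB i => ?_⟩
  rw [dotProduct_eq_sum_subtype hu]
  exact hann u hu (fun i hi => huB i (hbB (by simpa using hi))) _ (hspan ⟨i, Set.mem_univ i, rfl⟩)

/-- A union bound over the support `T` of the null vector and a set `B` of rows that span all rows
on `T`: the rows in `B` determine a vector to which every other row is orthogonal, which has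
probability at most `1 / 2` for each. -/
theorem density_sparseNull_le (α β : Type*) [Fintype α] [Fintype β] {m : ℕ}
    (hm : m ≤ Fintype.card α) :
    density (sparseNull α β (m + 1)) ≤
      (Fintype.card β).choose (m + 1) * (Fintype.card α).choose m *
        (1 / 2) ^ (Fintype.card α - m) := by
  classical
  let E : Finset β × Finset α → Set (α → β → Bool) := fun p =>
    {C | ∀ u : β → ℝ, (∀ j ∉ p.1, u j = 0) →
      (∀ i ∈ p.2, u ⬝ᵥ boolVec (C i) = 0) → ∀ i, u ⬝ᵥ boolVec (C i) = 0}
  let s := (Finset.powersetCard (m + 1) (Finset.univ : Finset β)) ×ˢ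
    (Finset.powersetCard m (Finset.univ : Finset α))
  have hsub : sparseNull α β (m + 1) ⊆ {C | ∃ p ∈ s, C ∈ E p} := by
    rintro C ⟨T, hT, w, hw, hwT, h⟩
    obtain ⟨B, hB, hBu⟩ := exists_spanning_rows hm (fun i => boolVec (C i)) hT hw hwT h
    exact ⟨(T, B), by simp [s, Finset.mem_powersetCard, hT, hB], hBu⟩
  refine (density_mono hsub).trans ((density_biUnion_le s E ?_).trans_eq (by
    simp only [s, Finset.card_product, Finset.card_powersetCard, Finset.card_univ, Nat.cast_mul]
    rfl))
  rintro ⟨T, B⟩ hp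
  simp only [s, Finset.mem_product, Finset.mem_powersetCard] at hp
  obtain ⟨⟨-, hT⟩, -, hB⟩ := hp
  have h := density_le_of_slices
    (Equiv.piEquivPiSubtypeProd (· ∈ B) (fun _ : α => β → Bool)) (S := E (T, B)) ∅
    (c := (1 / 2) ^ (Fintype.card α - m)) (by positivity) ?_
  · simpa [density] using h
  intro f _
  obtain ⟨w, hw, hwT, hwf⟩ := exists_ne_zero_dotProduct_eq_zero
    (fun i : {i // i ∈ B} => boolVec (f i)) T (by rw [Fintype.card_coe, hB, hT]; omega)
  have hcardB : Nat.card {i // i ∉ B} = Fintype.card α - m := by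
    rw [Nat.card_eq_fintype_card, Fintype.card_subtype_compl, Fintype.card_coe, hB]
  rw [← hcardB]
  refine le_trans (density_mono (T := {D | ∀ i, D i ∈ {r | w ⬝ᵥ boolVec r = 0}}) ?_) ?_
  · intro D hD i
    have h1 := hD w hwT (fun i hi => by
      simpa [Equiv.piEquivPiSubtypeProd, hi] using hwf ⟨i, hi⟩) i
    simpa [Equiv.piEquivPiSubtypeProd, i.2] using h1
  · rw [density_forall_mem]
    exact pow_le_pow_left₀ (density_nonneg _) (density_dotProduct_boolVec_eq_zero_le_half hw) _

/-! ### Komlós's theorem on singular random matrices -/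

/-- The Boolean matrices whose rows, read as real vectors, are linearly dependent. -/
def dependentRows (α β : Type*) : Set (α → β → Bool) :=
  {C | ¬ LinearIndependent ℝ fun i => boolVec (C i)}

/-- The row `i` of a square matrix is in the span of the others with small probability: outside the
matrices for which all normals of the span of the others are dense, the Littlewood–Offord
inequality for a normal applies. -/
theorem density_row_mem_span_le (n m : ℕ) (hm : m < n) (i : Fin n) :
    density {C : Fin n → Fin n → Bool |
        ∃ g : Fin n → ℝ, ∑ j, g j • boolVec (C j) = 0 ∧ g i ≠ 0} ≤
      n.choose (m + 1) * (n - 1).choose m * (1 / 2) ^ (n - 1 - m) +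
        ((m + 1).choose ((m + 1) / 2) : ℝ) / 2 ^ (m + 1) := by
  classical
  have hcard : Fintype.card {j : Fin n // j ≠ i} = n - 1 := by
    simp
  refine (density_le_of_slices ((Equiv.funSplitAt i (Fin n → Bool)).trans (Equiv.prodComm _ _))
    (sparseNull {j : Fin n // j ≠ i} (Fin n) (m + 1))
    (c := ((m + 1).choose ((m + 1) / 2) : ℝ) / 2 ^ (m + 1)) (by positivity) ?_).trans ?_
  · intro f hf
    obtain ⟨w, hw, -, hwf⟩ := exists_ne_zero_dotProduct_eq_zero
      (fun j : {j : Fin n // j ≠ i} => boolVec (f j)) Finset.univ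
      (by rw [hcard, Finset.card_univ, Fintype.card_fin]; omega)
    have hsupp : m + 1 ≤ (Finset.univ.filter fun j => w j ≠ 0).card := by
      by_contra! hlt
      obtain ⟨T, hsub, hT⟩ := Finset.exists_superset_card_eq hlt.le
        (by rw [Fintype.card_fin]; omega)
      refine hf ⟨T, hT, w, hw, fun j hj => ?_, hwf⟩
      by_contra hj0
      exact hj (hsub (by simpa using hj0))
    obtain ⟨T, hTsub, hT⟩ := Finset.exists_subset_card_eq hsupp
    have hLO := density_dotProduct_boolVec_eq_le w T
      (fun j hj => (Finset.mem_filter.1 (hTsub hj)).2) 0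
    rw [hT] at hLO
    refine (density_mono ?_).trans hLO
    rintro r ⟨g, hg, hgi⟩
    have h1 : ∑ j, g j * (w ⬝ᵥ boolVec
        (((Equiv.funSplitAt i (Fin n → Bool)).trans (Equiv.prodComm _ _)).symm (f, r) j)) = 0 := by
      have := congrArg (fun x => w ⬝ᵥ x) hg
      simpa [dotProduct_sum, dotProduct_smul] using this
    rw [Finset.sum_eq_single i] at h1
    · have h2 := (mul_eq_zero.1 h1).resolve_left hgi
      simpa [Equiv.funSplitAt, Equiv.piSplitAt] using h2
    · intro j _ hj
      have := hwf ⟨j, hj⟩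
      simp [Equiv.funSplitAt, Equiv.piSplitAt, hj, this]
    · simp
  · gcongr
    refine (density_sparseNull_le _ _ ?_).trans_eq ?_
    · rw [hcard]; omega
    · rw [hcard, Fintype.card_fin]

theorem density_dependentRows_le (n m : ℕ) (hm : m < n) :
    density (dependentRows (Fin n) (Fin n)) ≤
      n.choose (m + 1) * n.choose m * (1 / 2) ^ (n - m) +
      (n : ℝ) / (m + 1 : ℕ) * (n.choose (m + 1) * (n - 1).choose m * (1 / 2) ^ (n - 1 - m) +
        ((m + 1).choose ((m + 1) / 2) : ℝ) / 2 ^ (m + 1)) := by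
  classical
  let E : Fin n → Set (Fin n → Fin n → Bool) := fun i =>
    {C | ∃ g : Fin n → ℝ, ∑ j, g j • boolVec (C j) = 0 ∧ g i ≠ 0}
  let D : Set (Fin n → Fin n → Bool) := {C | m + 1 ≤ {i | C ∈ E i}.ncard}
  let Tr : (Fin n → Fin n → Bool) ≃ (Fin n → Fin n → Bool) := Equiv.piComm _
  have hsub : dependentRows (Fin n) (Fin n) ⊆ Tr ⁻¹' (sparseNull (Fin n) (Fin n) (m + 1)) ∪ D := by
    intro C hC
    obtain ⟨g, hg, i, hi⟩ := Fintype.not_linearIndependent_iff.1 hC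
    by_cases hcard : m + 1 ≤ (Finset.univ.filter fun j => g j ≠ 0).card
    · right
      refine hcard.trans ?_
      rw [← Set.ncard_coe_finset]
      refine Set.ncard_le_ncard fun j hj => ⟨g, hg, by simpa using hj⟩
    · left
      obtain ⟨T, hsub, hT⟩ := Finset.exists_superset_card_eq (not_le.1 hcard).le
        (by rw [Fintype.card_fin]; omega)
      refine ⟨T, hT, g, Function.ne_iff.2 ⟨i, hi⟩, fun j hj => ?_, fun j => ?_⟩
      · by_contra hj0
        exact hj (hsub (by simpa using hj0))
      · simpa [boolVec, dotProduct, Tr] using congr_fun hg j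
  have hTr : density (Tr ⁻¹' (sparseNull (Fin n) (Fin n) (m + 1))) =
      density (sparseNull (Fin n) (Fin n) (m + 1)) := by
    unfold density
    rw [Set.ncard_preimage_of_injective_subset_range Tr.injective (by simp)]
  have h1 : density (sparseNull (Fin n) (Fin n) (m + 1)) ≤ _ :=
    density_sparseNull_le _ _ (by rw [Fintype.card_fin]; omega)
  rw [Fintype.card_fin] at h1
  have h2 := mul_density_le_sum E (S := D) (m + 1) fun C hC => hC
  have h3 := h2.trans (Finset.sum_le_sum fun i _ => density_row_mem_span_le n m hm i)
  rw [Finset.sum_const, Finset.card_univ, Fintype.card_fin, nsmul_eq_mul] at h3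
  have hm0 : (0 : ℝ) < (m + 1 : ℕ) := by positivity
  have h4 : density D ≤ (n : ℝ) / (m + 1 : ℕ) *
      (n.choose (m + 1) * (n - 1).choose m * (1 / 2) ^ (n - 1 - m) +
        ((m + 1).choose ((m + 1) / 2) : ℝ) / 2 ^ (m + 1)) := by
    rw [div_mul_eq_mul_div, le_div_iff₀ hm0, mul_comm]
    exact h3
  calc _ ≤ _ := density_mono hsub
    _ ≤ _ := density_union_le _ _
    _ ≤ _ := by rw [hTr]; exact add_le_add h1 h4

/-- The union bounds for sparse null vectors are negligible. Here `2 * n` bounds the number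
`1 + n` of times that such a bound is paid, and `y = n ^ (1 / 8)`, so that `log n ≤ 8 * y`. -/
theorem two_mul_pow_mul_half_pow_le_exp_neg {n k : ℕ} {y : ℝ} (hy : 200 ≤ y)
    (hn : (n : ℝ) = y ^ 8) (hkn : k ≤ n) (hk : (k : ℝ) ≤ 4 * y ^ 6) :
    2 * (n : ℝ) * (n : ℝ) ^ (2 * k) * (1 / 2) ^ (n - k) ≤ Real.exp (-y) := by
  have h1 : (n : ℝ) ≤ Real.exp (8 * y) := by
    rw [hn, mul_comm, Real.exp_mul]
    have : y ≤ Real.exp y := by linarith [Real.add_one_le_exp y]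
    have h8 : Real.exp y ^ (8 : ℝ) = Real.exp y ^ 8 := by norm_cast
    rw [h8]
    gcongr
  have h2 : (2 : ℝ) ≤ Real.exp 1 := by linarith [Real.add_one_le_exp (1 : ℝ)]
  have h3 : (1 / 2 : ℝ) ≤ Real.exp (-1 / 2) := by linarith [Real.add_one_le_exp (-1 / 2 : ℝ)]
  calc 2 * (n : ℝ) * (n : ℝ) ^ (2 * k) * (1 / 2) ^ (n - k)
      ≤ Real.exp 1 * Real.exp (8 * y) * Real.exp (8 * y) ^ (2 * k) *
          Real.exp (-1 / 2) ^ (n - k) := by gcongr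
    _ = Real.exp (1 + 8 * y + (2 * k : ℕ) * (8 * y) + (n - k : ℕ) * (-1 / 2)) := by
        rw [Real.exp_add, Real.exp_add, Real.exp_add, Real.exp_nat_mul, Real.exp_nat_mul]
    _ ≤ Real.exp (-y) := by
        rw [Real.exp_le_exp]
        push_cast [Nat.cast_sub hkn]
        rw [hn]
        have h67 : y ^ 6 ≤ y ^ 7 := pow_le_pow_right₀ (by linarith) (by norm_num)
        have h17 : y ≤ y ^ 7 := le_self_pow₀ (by linarith) (by norm_num)
        have h07 : 1 ≤ y ^ 7 := one_le_pow₀ (by linarith)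
        have h78 : 200 * y ^ 7 ≤ y ^ 8 := by
          rw [pow_succ y 7, mul_comm]
          gcongr
        have hky : (k : ℝ) * y ≤ 4 * y ^ 7 := by
          calc (k : ℝ) * y ≤ 4 * y ^ 6 * y := by gcongr
            _ = 4 * y ^ 7 := by ring
        linarith

/-- The number `k` of nonzero coordinates above which null vectors count as dense is about
`n ^ (3 / 4)`: it has to be of larger order than `n ^ (2 / 3)`, so that `n / k * k ^ (-1 / 2)` tends
to `0`, and of smaller order than `n / log n`, so that the union bound over the supports succeeds.
Powers of `y = n ^ (1 / 8)` avoid fractional exponents. -/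
theorem density_dependentRows_le_of_eq_pow {n : ℕ} {y : ℝ} (hy : 200 ≤ y)
    (hn : (n : ℝ) = y ^ 8) :
    density (dependentRows (Fin n) (Fin n)) ≤ Real.exp (-y) + y⁻¹ := by
  have hy0 : 0 < y := by linarith
  obtain ⟨q, hq1, hq2⟩ : ∃ q : ℕ, y ^ 6 ≤ q ∧ (q : ℝ) ≤ 2 * y ^ 6 := by
    refine ⟨⌈y ^ 6⌉₊, Nat.le_ceil _, ?_⟩
    have h1 := Nat.ceil_lt_add_one (a := y ^ 6) (by positivity)
    have h2 : 1 ≤ y ^ 6 := one_le_pow₀ (by linarith)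
    linarith
  have hq0 : 0 < q := by
    have : (0 : ℝ) < q := lt_of_lt_of_le (by positivity) hq1
    exact_mod_cast this
  have hk4 : ((2 * q : ℕ) : ℝ) ≤ 4 * y ^ 6 := by push_cast; linarith
  have hkn : 2 * q ≤ n := by
    have : ((2 * q : ℕ) : ℝ) ≤ n := by
      rw [hn]
      calc _ ≤ 4 * y ^ 6 := hk4
        _ ≤ y ^ 2 * y ^ 6 := by gcongr; nlinarith
        _ = y ^ 8 := by ring
    exact_mod_cast this
  have hn1 : (1 : ℝ) ≤ n := by
    have : 1 ≤ n := by omega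
    exact_mod_cast this
  have hmain := density_dependentRows_le n (2 * q - 1) (by omega)
  have hm1 : 2 * q - 1 + 1 = 2 * q := by omega
  have hnm : n - 1 - (2 * q - 1) = n - 2 * q := by omega
  rw [hm1, hnm] at hmain
  have hc1 : (n.choose (2 * q) : ℝ) ≤ (n : ℝ) ^ (2 * q) := by
    exact_mod_cast Nat.choose_le_pow n _
  have hc2 : (n.choose (2 * q - 1) : ℝ) ≤ (n : ℝ) ^ (2 * q) := by
    calc (n.choose (2 * q - 1) : ℝ) ≤ (n : ℝ) ^ (2 * q - 1) := by
          exact_mod_cast Nat.choose_le_pow n _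
      _ ≤ _ := pow_le_pow_right₀ hn1 (by omega)
  have hc3 : ((n - 1).choose (2 * q - 1) : ℝ) ≤ (n : ℝ) ^ (2 * q) := by
    refine le_trans ?_ hc2
    exact_mod_cast Nat.choose_le_choose _ (Nat.sub_le _ _)
  have hhalf : (1 / 2 : ℝ) ^ (n - (2 * q - 1)) ≤ (1 / 2) ^ (n - 2 * q) :=
    pow_le_pow_of_le_one (by norm_num) (by norm_num) (by omega)
  have hLO := choose_half_div_two_pow_le hq0
  have hq0' : (0 : ℝ) < (2 * q : ℕ) := by exact_mod_cast (by omega : 0 < 2 * q)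
  have hnk : (n : ℝ) / (2 * q : ℕ) ≤ n :=
    div_le_self (by linarith) (by exact_mod_cast (by omega : 1 ≤ 2 * q))
  have hk6 : y ^ 6 ≤ (2 * q : ℕ) := by
    push_cast
    linarith [hq1, (Nat.cast_nonneg q : (0 : ℝ) ≤ q)]
  have hdense : (n : ℝ) / (2 * q : ℕ) * (((2 * q).choose (2 * q / 2) : ℝ) / 2 ^ (2 * q)) ≤
      y⁻¹ := by
    have hs : y ^ 3 ≤ √(2 * q : ℝ) := by
      refine Real.le_sqrt_of_sq_le ?_
      push_cast at hk6
      calc (y ^ 3) ^ 2 = y ^ 6 := by ring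
        _ ≤ _ := hk6
    calc _ ≤ y ^ 8 / y ^ 6 * (1 / y ^ 3) := by
          rw [hn]
          refine mul_le_mul (by gcongr) (hLO.trans ?_) (by positivity) (by positivity)
          gcongr
      _ = y⁻¹ := by field_simp
  have hexp := two_mul_pow_mul_half_pow_le_exp_neg hy hn hkn hk4
  have hsum : (n.choose (2 * q) : ℝ) * n.choose (2 * q - 1) * (1 / 2) ^ (n - (2 * q - 1)) +
      (n : ℝ) / (2 * q : ℕ) * (n.choose (2 * q) * (n - 1).choose (2 * q - 1) *
        (1 / 2) ^ (n - 2 * q)) ≤ Real.exp (-y) := by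
    refine le_trans ?_ hexp
    calc _ ≤ (n : ℝ) ^ (2 * q) * (n : ℝ) ^ (2 * q) * (1 / 2) ^ (n - 2 * q) +
          n * ((n : ℝ) ^ (2 * q) * (n : ℝ) ^ (2 * q) * (1 / 2) ^ (n - 2 * q)) := by gcongr
      _ = (1 + n) * ((n : ℝ) ^ (2 * (2 * q)) * (1 / 2) ^ (n - 2 * q)) := by
          rw [two_mul (2 * q), pow_add]
          ring
      _ ≤ (2 * n) * ((n : ℝ) ^ (2 * (2 * q)) * (1 / 2) ^ (n - 2 * q)) := by
          gcongr
          linarith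
      _ = _ := by ring
  rw [mul_add] at hmain
  linarith

/-- Komlós's theorem: a random square `0`-`1` matrix is nonsingular with probability tending
to `1`. -/
theorem tendsto_density_dependentRows :
    Tendsto (fun n : ℕ => density (dependentRows (Fin n) (Fin n))) atTop (𝓝 0) := by
  have hy : Tendsto (fun n : ℕ => (n : ℝ) ^ (1 / 8 : ℝ)) atTop atTop :=
    (tendsto_rpow_atTop (by norm_num)).comp tendsto_natCast_atTop_atTop
  have hlim : Tendsto (fun n : ℕ => Real.exp (-((n : ℝ) ^ (1 / 8 : ℝ))) +
      ((n : ℝ) ^ (1 / 8 : ℝ))⁻¹) atTop (𝓝 0) := by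
    simpa using (Real.tendsto_exp_neg_atTop_nhds_zero.comp hy).add
      (tendsto_inv_atTop_zero.comp hy)
  refine squeeze_zero' (Eventually.of_forall fun n => density_nonneg _) ?_ hlim
  filter_upwards [hy.eventually_ge_atTop 200] with n hn
  refine density_dependentRows_le_of_eq_pow hn ?_
  rw [← Real.rpow_natCast, ← Real.rpow_mul (Nat.cast_nonneg n)]
  norm_num

/-! ### Reduction of rectangular to square matrices -/

/-- Each row is complemented if its entry at `z` is `1`, and only the columns `e j` are kept.
On Booleans, addition is exclusive or, so this is a homomorphism. -/
def xorColumns {α β γ : Type*} (e : γ → β) (z : β) : (α → β → Bool) →+ (α → γ → Bool) where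
  toFun C i j := C i (e j) + C i z
  map_zero' := by ext; simp
  map_add' C D := by
    ext i j
    simp only [Pi.add_apply]
    rw [add_add_add_comm]

theorem xorColumns_surjective {α β γ : Type*} {e : γ → β} (he : Function.Injective e) {z : β}
    (hz : z ∉ Set.range e) : Function.Surjective (xorColumns (α := α) e z) := by
  intro D
  refine ⟨fun i => Function.extend e (D i) 0, ?_⟩
  ext i j
  simp only [xorColumns, AddMonoidHom.coe_mk, ZeroHom.coe_mk]
  rw [he.extend_apply, Function.extend_apply' _ _ _ (by simpa using hz), Pi.zero_apply, add_zero]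

/-- Complementing rows does not change their span together with the all-ones vector. If that vector
is already in the span of the rows, a relation among the complemented rows remains. -/
theorem xorColumns_mem_dependentRows {α β γ : Type*} [Fintype α] (e : γ → β) (z : β)
    {C : α → β → Bool}
    (h : (1 : β → ℝ) ∈ Submodule.span ℝ (Set.range fun i => boolVec (C i))) :
    xorColumns e z C ∈ dependentRows α γ := by
  obtain ⟨a, ha⟩ := (Submodule.mem_span_range_iff_exists_fun ℝ).1 h
  have ha' : ∀ j, ∑ i, a i * boolVec (C i) j = 1 := fun j => by simpa using congr_fun ha j
  refine Fintype.not_linearIndependent_iff.2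
    ⟨fun i => a i * (1 - 2 * boolVec (C i) z), funext fun j => ?_, ?_⟩
  · have hterm : ∀ i, a i * (1 - 2 * boolVec (C i) z) * boolVec (xorColumns e z C i) j =
        a i * boolVec (C i) (e j) - a i * boolVec (C i) z := fun i => by
      have hx : xorColumns e z C i j = xor (C i (e j)) (C i z) := rfl
      simp only [boolVec, hx]
      cases C i (e j) <;> cases C i z <;> norm_num
    simp only [Finset.sum_apply, Pi.smul_apply, smul_eq_mul, Pi.zero_apply, hterm]
    rw [Finset.sum_sub_distrib, ha', ha', sub_self]
  · by_contra! h0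
    have hz := ha' z
    rw [Finset.sum_eq_zero] at hz
    · exact zero_ne_one hz
    · intro i _
      have hi := h0 i
      by_cases hc : C i z = true
      · simp only [boolVec, hc, if_true] at hi
        have : a i = 0 := by linarith
        rw [this, zero_mul]
      · simp [boolVec, hc]

/-- The restriction of a matrix to the rows `e i`. -/
def restrictRows {α β γ : Type*} (e : γ → α) : (α → β → Bool) →+ (γ → β → Bool) where
  toFun C i := C (e i)
  map_zero' := rfl
  map_add' _ _ := rfl

theorem span_eq_top_of_restrictRows_notMem {α β : Type*} [Fintype β]
    (e : β → α) {C : α → β → Bool} (h : restrictRows e C ∉ dependentRows β β) :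
    Submodule.span ℝ (Set.range fun i => boolVec (C i)) = ⊤ := by
  have hli : LinearIndependent ℝ fun i => boolVec (C (e i)) := not_not.1 h
  have htop := hli.span_eq_top_of_card_eq_finrank' (by simp)
  refine top_le_iff.1 (htop.symm.le.trans (Submodule.span_mono ?_))
  rintro _ ⟨i, rfl⟩
  exact ⟨e i, rfl⟩

/-! ### The probability that a random network is ideal -/

theorem bernoulliMeasure_singleton {p : unitInterval} (hp : (p : ℝ) = 1 / 2) (b : Bool) :
    ProbabilityTheory.bernoulliMeasure true false p {b} = 2⁻¹ := by
  have h1 : unitInterval.toNNReal p = 2⁻¹ := by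
    ext; simp [hp]
  have h2 : unitInterval.toNNReal (unitInterval.symm p) = 2⁻¹ := by
    ext; norm_num [hp]
  cases b
  · rw [ProbabilityTheory.bernoulliMeasure_apply_of_notMem_of_mem p
      (measurableSet_singleton false) (by simp) (by simp), h2]
    simp
  · rw [ProbabilityTheory.bernoulliMeasure_apply_of_mem_of_notMem p
      (measurableSet_singleton true) (by simp) (by simp), h1]
    simp

theorem randomConnections_real_eq_density (L₁ L₂ : ℕ) (S : Set (Fin L₂ → Fin L₁ → Bool)) :
    (randomConnections L₁ L₂).real S = density S := by
  classical
  have hb := bernoulliMeasure_singleton (p := ⟨1 / 2, by norm_num, by norm_num⟩) rfl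
  have hC : ∀ C, randomConnections L₁ L₂ {C} = 2⁻¹ ^ (L₁ * L₂) := fun C => by
    rw [randomConnections, Measure.pi_singleton]
    simp only [Measure.pi_singleton, hb, Finset.prod_const, Finset.card_univ, Fintype.card_fin]
    rw [pow_mul]
  have hS : randomConnections L₁ L₂ S = S.ncard * 2⁻¹ ^ (L₁ * L₂) := by
    have h1 := sum_measure_singleton (μ := randomConnections L₁ L₂) (s := S.toFinset)
    rw [Set.coe_toFinset] at h1
    rw [← h1]
    simp [hC, Set.ncard_eq_toFinset_card']
  rw [Measure.real, hS, density]
  simp [Nat.card_eq_fintype_card, ← pow_mul, div_eq_mul_inv]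

theorem density_isIdealNetwork_ge {L₁ L₂ : ℕ} (h : L₁ ≤ L₂) {v : Fin L₁ → ℝ≥0}
    (hv : ∀ i, 0 < v i) :
    1 - density (dependentRows (Fin L₁) (Fin L₁)) ≤
      density {C : Fin L₂ → Fin L₁ → Bool | IsIdealNetwork v C} := by
  have hsurj : Function.Surjective
      (restrictRows (β := Fin L₁) (Fin.castLE h)) :=
    (Fin.castLE_injective h).surjective_comp_right
  rw [← density_preimage_of_surjective _ hsurj, ← density_compl]
  refine density_mono fun C hC => isIdealNetwork_of_one_mem_span hv ?_
  rw [span_eq_top_of_restrictRows_notMem _ hC]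
  exact Submodule.mem_top

theorem density_isIdealNetwork_le {L₁ L₂ : ℕ} (h : L₂ < L₁) {v : Fin L₁ → ℝ≥0}
    (hv : ∀ i, 0 < v i) :
    density {C : Fin L₂ → Fin L₁ → Bool | IsIdealNetwork v C} ≤
      density (dependentRows (Fin L₂) (Fin L₂)) := by
  have he : Function.Injective fun j : Fin L₂ => Fin.castLE h j.succ :=
    (Fin.castLE_injective h).comp (Fin.succ_injective L₂)
  have hz : Fin.castLE h 0 ∉ Set.range fun j : Fin L₂ => Fin.castLE h j.succ := by
    rintro ⟨j, hj⟩
    exact Fin.succ_ne_zero j (Fin.castLE_injective h hj)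
  rw [← density_preimage_of_surjective _ (xorColumns_surjective he hz)]
  exact density_mono fun C hC => xorColumns_mem_dependentRows _ _
    (one_mem_span_of_isIdealNetwork (Nat.zero_lt_of_lt h) hv hC)

end FeedforwardInference

end

/-- Random three-layer networks: for every choice of positive measurement variances, which may vary
with the layer sizes, the probability that the network is ideal tends to `1` as both layer sizes
grow with `L₁ / L₂ ≤ 1`, and to `0` as they grow with `L₁ / L₂ > 1`. -/
theorem corollary3
    (v : (L : ℕ × ℕ) → Fin L.1 → ℝ≥0) (hv : ∀ L i, 0 < v L i) :
    Tendsto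
      (fun L : ℕ × ℕ => (FeedforwardInference.randomConnections L.1 L.2).real
        {C | FeedforwardInference.IsIdealNetwork (v L) C})
      ((atTop ×ˢ atTop) ⊓ 𝓟 {L : ℕ × ℕ | (L.1 : ℝ) / (L.2 : ℝ) ≤ 1}) (𝓝 1) ∧
    Tendsto
      (fun L : ℕ × ℕ => (FeedforwardInference.randomConnections L.1 L.2).real
        {C | FeedforwardInference.IsIdealNetwork (v L) C})
      ((atTop ×ˢ atTop) ⊓ 𝓟 {L : ℕ × ℕ | 1 < (L.1 : ℝ) / (L.2 : ℝ)}) (𝓝 0) := by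
  simp only [FeedforwardInference.randomConnections_real_eq_density]
  have hpos : ∀ s : Set (ℕ × ℕ), ∀ᶠ L : ℕ × ℕ in (atTop ×ˢ atTop) ⊓ 𝓟 s, (0 : ℝ) < L.2 :=
    fun s => ((tendsto_snd.mono_left inf_le_left).eventually_gt_atTop 0).mono
      fun L hL => by exact_mod_cast hL
  have hmem : ∀ s : Set (ℕ × ℕ), ∀ᶠ L : ℕ × ℕ in (atTop ×ˢ atTop) ⊓ 𝓟 s, L ∈ s :=
    fun s => mem_inf_of_right (mem_principal_self s)
  have hp := FeedforwardInference.tendsto_density_dependentRows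
  constructor
  · have hlim := (hp.comp (tendsto_fst.mono_left inf_le_left :
      Tendsto Prod.fst ((atTop ×ˢ atTop) ⊓ 𝓟 {L : ℕ × ℕ | (L.1 : ℝ) / (L.2 : ℝ) ≤ 1})
        atTop)).const_sub 1
    rw [sub_zero] at hlim
    refine tendsto_of_tendsto_of_tendsto_of_le_of_le' hlim tendsto_const_nhds ?_
      (Eventually.of_forall fun L => FeedforwardInference.density_le_one _)
    filter_upwards [hpos _, hmem _] with L h0 hL
    have hle : L.1 ≤ L.2 := by exact_mod_cast (div_le_one h0).1 hL
    exact FeedforwardInference.density_isIdealNetwork_ge hle (hv L)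
  · have hlim := hp.comp (tendsto_snd.mono_left inf_le_left :
      Tendsto Prod.snd ((atTop ×ˢ atTop) ⊓ 𝓟 {L : ℕ × ℕ | 1 < (L.1 : ℝ) / (L.2 : ℝ)}) atTop)
    refine squeeze_zero' (Eventually.of_forall fun L => FeedforwardInference.density_nonneg _)
      ?_ hlim
    filter_upwards [hpos _, hmem _] with L h0 hL
    have hlt : L.2 < L.1 := by exact_mod_cast (one_lt_div h0).1 hL
    exact FeedforwardInference.density_isIdealNetwork_le hlt (hv L)
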